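/- A partition is a finite weakly decreasing sequence $\lambda=(\lambda_1,\dots,\lambda_n)$ of positive integers. The hook of a cell of its Young diagram consists of the cell itself, the cells to its right and the cells below it, and the hook length is the number of cells in the hook. The partition is an $s$-core if no cell has hook length $s$, an $(s,t)$-core if it is both an $s$-core and a $t$-core, and it has $d$-distinct parts if $\lambda_i-\lambda_{i+1}\ge d$ for $1\le i\le n-1$. Let $H_d(s,k)$ denote the maximum hook length occurring among the $(s,s+k)$-cores with $d$-distinct parts. **Theorem.** Let $s,k,d$ be positive integers with $s\ge 2$ and $\gcd(s,k)=1$, and let $b\ge 2$ and $0\le c<b$ be integers. Write $a \bmod k\in\{0,\dots,k-1\}$ for the remainder of $a$ modulo $k$ and put $$\overline{s}=s\bmod k,\qquad \widetilde{s}=\min\{\ell\cdot \overline{s}^{\,-1}\bmod k \;:\; \ell\in\mathbb Z,\ -d\le \ell\le d,\ \ell\ne 0\},\qquad r=\overline{s}\,\widetilde{s}\bmod k,$$ where $\overline{s}^{\,-1}$ is the inverse modulo $k$. Then the maxima $H_d(s,k)$ and $H_{bd+c}(bs,bk)$ exist, and $$H_{bd+c}(bs,bk)=\begin{cases} b\,(H_d(s,k)+2)-1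 & \text{if } k=1 \text{ and } d<s,\\ b\,(H_d(s,k)+1)-1 & \text{if } k=1 \text{ and } d\ge s,\\ b\,(H_d(s,k)+2)-1 & \text{if } d<k \text{ and } (r=1 \text{ or } d<r=k-1),\\ b\,(H_d(s,k)+1)-1 & \text{if } k>1 \text{ and } (1<r\le d \text{ or } d<r<k-1 \text{ or } d\ge k), \end{cases}$$ where the four cases cover all such $s,k,d$. -/

import Mathlib

/-- The hook of the cell `(i, j)` of a Young diagram (row `i`, column `j`, both counted from `0`):
the cell itself, the cells to its right and the cells below it. -/
def YoungDiagram.hook (μ : YoungDiagram) (i j : ℕ) : Finset (ℕ × ℕ) :=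
  μ.cells.filter (fun x => (x.1 = i ∧ j ≤ x.2) ∨ (x.2 = j ∧ i ≤ x.1))

/-- The hook length of the cell `(i, j)`. -/
def YoungDiagram.hookLength (μ : YoungDiagram) (i j : ℕ) : ℕ := (μ.hook i j).card

/-- A partition (given by its Young diagram) is an `s`-core if no cell has hook length `s`. -/
def YoungDiagram.IsCore (μ : YoungDiagram) (s : ℕ) : Prop :=
  ∀ i j : ℕ, (i, j) ∈ μ → μ.hookLength i j ≠ s

/-- A partition has `d`-distinct parts if consecutive parts differ by at least `d`. The parts are
the row lengths with index less than the number `μ.colLen 0` of rows. -/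
def YoungDiagram.IsDistinct (μ : YoungDiagram) (d : ℕ) : Prop :=
  ∀ i : ℕ, i + 1 < μ.colLen 0 → μ.rowLen (i + 1) + d ≤ μ.rowLen i

/-- All hook lengths that occur in `(s, t)`-cores with `d`-distinct parts. -/
def coreHookLengths (d s t : ℕ) : Set ℕ :=
  {h | ∃ μ : YoungDiagram, μ.IsCore s ∧ μ.IsCore t ∧ μ.IsDistinct d ∧
    ∃ i j : ℕ, (i, j) ∈ μ ∧ μ.hookLength i j = h}

/-- `maxHook d s k` is the maximum possible hook length `H_d(s, k)` of an `(s, s + k)`-core with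
`d`-distinct parts (meaningful when the set of these hook lengths is nonempty and bounded). -/
noncomputable def maxHook (d s k : ℕ) : ℕ := sSup (coreHookLengths d s (s + k))

/-- The least of the residues `ℓ * s⁻¹ mod k` over nonzero integers `ℓ` with `-d ≤ ℓ ≤ d`, the
inverse being taken modulo `k`. -/
noncomputable def sTilde (d s k : ℕ) : ℕ :=
  sInf {m | ∃ l : ℤ, l ≠ 0 ∧ -(d : ℤ) ≤ l ∧ l ≤ (d : ℤ) ∧
    m = ((l : ZMod k) * ((s % k : ℕ) : ZMod k)⁻¹).val}

/-- The residue modulo `k` of the product of `s mod k` and `sTilde d s k`. -/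
noncomputable def sRes (d s k : ℕ) : ℕ := ((s % k) * sTilde d s k) % k

namespace YoungDiagram

theorem hookLength_add (μ : YoungDiagram) {i j : ℕ} (h : (i, j) ∈ μ) :
    μ.hookLength i j + i + j + 1 = μ.rowLen i + μ.colLen j := by
  have hr : j < μ.rowLen i := mem_iff_lt_rowLen.1 h
  have hc : i < μ.colLen j := mem_iff_lt_colLen.1 h
  have key : μ.hook i j = (Finset.Ico j (μ.rowLen i)).image (fun y => (i, y)) ∪
      (Finset.Ico (i + 1) (μ.colLen j)).image (fun x => (x, j)) := by
    ext ⟨x, y⟩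
    simp only [hook, Finset.mem_filter, Finset.mem_union, Finset.mem_image, Finset.mem_Ico,
      Prod.mk.injEq, mem_cells]
    constructor
    · rintro ⟨hm, ⟨rfl, h1⟩ | ⟨rfl, h1⟩⟩
      · exact Or.inl ⟨y, ⟨h1, mem_iff_lt_rowLen.1 hm⟩, rfl, rfl⟩
      · rcases h1.eq_or_lt with rfl | h1
        · exact Or.inl ⟨y, ⟨le_rfl, hr⟩, rfl, rfl⟩
        · exact Or.inr ⟨x, ⟨h1, mem_iff_lt_colLen.1 hm⟩, rfl, rfl⟩
    · rintro (⟨z, ⟨h1, h2⟩, rfl, rfl⟩ | ⟨z, ⟨h1, h2⟩, rfl, rfl⟩)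
      · exact ⟨mem_iff_lt_rowLen.2 h2, Or.inl ⟨rfl, h1⟩⟩
      · exact ⟨mem_iff_lt_colLen.2 h2, Or.inr ⟨rfl, by omega⟩⟩
  rw [hookLength, key, Finset.card_union_of_disjoint, Finset.card_image_of_injective,
    Finset.card_image_of_injective, Nat.card_Ico, Nat.card_Ico]
  · omega
  · exact fun a b hab => (Prod.mk.inj hab).1
  · exact fun a b hab => (Prod.mk.inj hab).2
  · rw [Finset.disjoint_left]
    rintro ⟨x, y⟩ h1 h2
    simp only [Finset.mem_image, Finset.mem_Ico, Prod.mk.injEq] at h1 h2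
    omega

/-- The set of hook lengths in the first column of a Young diagram. -/
def betaSet (μ : YoungDiagram) : Finset ℕ :=
  (Finset.range (μ.colLen 0)).image (fun i => μ.rowLen i + (μ.colLen 0 - 1 - i))

theorem mem_betaSet {μ : YoungDiagram} {x : ℕ} :
    x ∈ μ.betaSet ↔ ∃ i < μ.colLen 0, x + i + 1 = μ.rowLen i + μ.colLen 0 := by
  simp only [betaSet, Finset.mem_image, Finset.mem_range]
  refine exists_congr fun i => and_congr_right fun hi => ?_
  omega

theorem lt_rowLen_iff_lt_colLen (μ : YoungDiagram) (i j : ℕ) :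
    j < μ.rowLen i ↔ i < μ.colLen j :=
  mem_iff_lt_rowLen.symm.trans mem_iff_lt_colLen

/-- The natural numbers outside the beta-set are the numbers `n + j - μ.colLen j`, with `n` the
number of rows. -/
theorem notMem_betaSet {μ : YoungDiagram} {y : ℕ} :
    y ∉ μ.betaSet ↔ ∃ j, y + μ.colLen j = μ.colLen 0 + j := by
  constructor
  · intro hy
    have hex : ∃ j, y + μ.colLen j ≤ μ.colLen 0 + j :=
      ⟨y, by have := μ.colLen_anti 0 y (Nat.zero_le _); omega⟩
    classical
    refine ⟨Nat.find hex, ?_⟩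
    have h1 := Nat.find_spec hex
    rcases hj : Nat.find hex with _ | j
    · rw [hj] at h1
      omega
    · rw [hj] at h1
      have h2 := Nat.find_min hex (m := j) (by omega)
      by_contra hne
      refine hy (mem_betaSet.2 ⟨μ.colLen 0 + j - y, ?_, ?_⟩)
      all_goals
        have a1 := μ.colLen_anti 0 j (Nat.zero_le _)
        have a2 := μ.lt_rowLen_iff_lt_colLen (μ.colLen 0 + j - y) j
        have a3 := μ.lt_rowLen_iff_lt_colLen (μ.colLen 0 + j - y) (j + 1)
        omega
  · rintro ⟨j, hj⟩ hy
    obtain ⟨i, hi, h⟩ := mem_betaSet.1 hy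
    have := μ.lt_rowLen_iff_lt_colLen i j
    omega

/-- The hook lengths are the differences `x - y` of a member `x` and a smaller nonmember `y` of
the beta-set. -/
theorem exists_hookLength_eq_iff {μ : YoungDiagram} {h : ℕ} :
    (∃ i j, (i, j) ∈ μ ∧ μ.hookLength i j = h) ↔
      0 < h ∧ ∃ x ∈ μ.betaSet, h ≤ x ∧ x - h ∉ μ.betaSet := by
  constructor
  · rintro ⟨i, j, hm, rfl⟩
    have h1 := μ.hookLength_add hm
    have h2 := mem_iff_lt_rowLen.1 hm
    have h3 := mem_iff_lt_colLen.1 hm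
    have h4 := μ.colLen_anti 0 j (Nat.zero_le _)
    refine ⟨by omega, μ.rowLen i + μ.colLen 0 - (i + 1),
      mem_betaSet.2 ⟨i, by omega, by omega⟩, by omega, notMem_betaSet.2 ⟨j, by omega⟩⟩
  · rintro ⟨h0, x, hx, hle, hy⟩
    obtain ⟨i, hi, h1⟩ := mem_betaSet.1 hx
    obtain ⟨j, h2⟩ := notMem_betaSet.1 hy
    have h3 := μ.lt_rowLen_iff_lt_colLen i j
    have hm : (i, j) ∈ μ := mem_iff_lt_colLen.2 (by omega)
    have h4 := μ.hookLength_add hm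
    exact ⟨i, j, hm, by omega⟩

theorem isCore_iff {μ : YoungDiagram} {s : ℕ} (hs : 0 < s) :
    μ.IsCore s ↔ ∀ x ∈ μ.betaSet, s ≤ x → x - s ∈ μ.betaSet := by
  have h := exists_hookLength_eq_iff (μ := μ) (h := s)
  constructor
  · intro hc x hx hle
    by_contra hn
    obtain ⟨i, j, hm, he⟩ := h.2 ⟨hs, x, hx, hle, hn⟩
    exact hc i j hm he
  · intro hb i j hm he
    obtain ⟨-, x, hx, hle, hn⟩ := h.1 ⟨i, j, hm, he⟩
    exact hn (hb x hx hle)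

theorem IsDistinct.add_lt {μ : YoungDiagram} {d : ℕ} (hμ : μ.IsDistinct d) {x y : ℕ}
    (hx : x ∈ μ.betaSet) (hy : y ∈ μ.betaSet) (hxy : x < y) : x + d < y := by
  obtain ⟨i, hi, h1⟩ := mem_betaSet.1 hx
  obtain ⟨j, hj, h2⟩ := mem_betaSet.1 hy
  have hji : j < i := by
    by_contra hle
    have := μ.rowLen_anti i j (by omega)
    omega
  have h3 := hμ j (by omega)
  have := μ.rowLen_anti (j + 1) i hji
  omega

theorem isDistinct_of_add_lt {μ : YoungDiagram} {d : ℕ}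
    (h : ∀ x ∈ μ.betaSet, ∀ y ∈ μ.betaSet, x < y → x + d < y) : μ.IsDistinct d := by
  intro i hi
  have := μ.rowLen_anti i (i + 1) (by omega)
  have := h (μ.rowLen (i + 1) + μ.colLen 0 - (i + 2)) (mem_betaSet.2 ⟨i + 1, hi, by omega⟩)
    (μ.rowLen i + μ.colLen 0 - (i + 1)) (mem_betaSet.2 ⟨i, by omega, by omega⟩) (by omega)
  omega

/-- Every finite set of positive integers is the beta-set of a Young diagram. -/
theorem exists_betaSet_eq (X : Finset ℕ) (hX : 0 ∉ X) : ∃ μ : YoungDiagram, μ.betaSet = X := by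
  set n := X.card with hn
  let f : Fin n ↪o ℕ := X.orderEmbOfFin hn.symm
  have hf : ∀ a b : Fin n, a ≤ b → f a + (b - a : ℕ) ≤ f b := by
    rintro ⟨a, ha⟩ ⟨b, hb⟩ hab
    simp only [Fin.mk_le_mk] at hab
    induction b, hab using Nat.le_induction with
    | base => simp
    | succ b hab ih =>
      have h1 := ih (by omega)
      have h2 : f ⟨b, by omega⟩ < f ⟨b + 1, hb⟩ := f.strictMono (by simp)
      simp only at h1 ⊢
      omega
  have hf' : ∀ a : Fin n, (a : ℕ) + 1 ≤ f a := by
    intro a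
    have h0 : 0 < n := a.pos
    have h1 := hf ⟨0, h0⟩ a (Fin.mk_le_of_le_val (Nat.zero_le _))
    have h2 : f ⟨0, h0⟩ ∈ X := X.orderEmbOfFin_mem hn.symm _
    have h3 : f ⟨0, h0⟩ ≠ 0 := fun h => hX (h ▸ h2)
    simp only at h1
    omega
  let w : List ℕ := List.ofFn fun i : Fin n => f i.rev - (i.rev : ℕ)
  have hw : w.SortedGE := by
    rw [List.sortedGE_ofFn_iff]
    intro a b hab
    have h1 := hf b.rev a.rev (Fin.rev_le_rev.2 hab)
    have h2 : (b.rev : ℕ) ≤ a.rev := Fin.rev_le_rev.2 hab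
    simp only
    omega
  have hpos : ∀ x ∈ w, 0 < x := by
    intro x hx
    obtain ⟨i, rfl⟩ := List.mem_ofFn.1 hx
    have := hf' i.rev
    omega
  have hwl : w.length = n := List.length_ofFn
  let μ := ofRowLens w hw
  have hrow : ∀ i : Fin n, μ.rowLen i = f i.rev - (i.rev : ℕ) := by
    intro i
    have := rowLen_ofRowLens (hw := hw) (⟨i, by rw [hwl]; exact i.2⟩ : Fin w.length)
    rw [show μ.rowLen i = _ from this]
    simp [w]
  have hcol : μ.colLen 0 = n := by
    have := rowLens_length_ofRowLens (hw := hw) hpos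
    rw [length_rowLens] at this
    exact this.trans hwl
  refine ⟨μ, ?_⟩
  ext x
  rw [mem_betaSet, hcol]
  have hmem : x ∈ X ↔ ∃ a, f a = x := by
    rw [← Set.mem_range, X.range_orderEmbOfFin hn.symm, Finset.mem_coe]
  rw [hmem]
  constructor
  · rintro ⟨i, hi, h⟩
    have h1 := hrow ⟨i, hi⟩
    have h2 := hf' (Fin.rev ⟨i, hi⟩)
    have h3 := Fin.val_rev ⟨i, hi⟩
    refine ⟨Fin.rev ⟨i, hi⟩, ?_⟩
    simp only at h1 h3
    omega
  · rintro ⟨a, rfl⟩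
    have h1 := hrow a.rev
    have h2 := hf' a
    have h3 := Fin.val_rev a
    rw [Fin.rev_rev] at h1
    refine ⟨a.rev, a.rev.2, ?_⟩
    omega

end YoungDiagram

/-- The additive semigroup generated by `0`, `s` and `t`. -/
def pairSemigroup (s t : ℕ) : Set ℕ := {x | ∃ a b, x = a * s + b * t}

/-- The number `q` lies in the semigroup generated by `s` and `t`, at distance at most `d` above
another of its elements. -/
def IsCloseAbove (d s t q : ℕ) : Prop :=
  q ∈ pairSemigroup s t ∧ ∃ p ∈ pairSemigroup s t, p < q ∧ q ≤ p + d

theorem sub_mem_of_mem_pairSemigroup {X : Finset ℕ} {s t : ℕ}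
    (hs : ∀ x ∈ X, s ≤ x → x - s ∈ X) (ht : ∀ x ∈ X, t ≤ x → x - t ∈ X) {x g : ℕ}
    (hx : x ∈ X) (hg : g ∈ pairSemigroup s t) (hle : g ≤ x) : x - g ∈ X := by
  have aux : ∀ u : ℕ, (∀ x ∈ X, u ≤ x → x - u ∈ X) → ∀ a x, x ∈ X → a * u ≤ x → x - a * u ∈ X := by
    intro u hu a
    induction a with
    | zero => intro x hx _; simpa using hx
    | succ a ih =>
      intro x hx hle
      rw [Nat.succ_mul] at hle ⊢
      have := hu _ (ih x hx (by omega)) (by omega)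
      rwa [Nat.sub_sub] at this
  obtain ⟨a, b, rfl⟩ := hg
  have := aux t ht b _ (aux s hs a x hx (by omega)) (by omega)
  rwa [Nat.sub_sub] at this

theorem mem_coreHookLengths_iff {d s t h : ℕ} (hs : 0 < s) (ht : 0 < t) :
    h ∈ coreHookLengths d s t ↔
      h ∉ pairSemigroup s t ∧ ∀ y ≤ h, ¬ IsCloseAbove d s t y := by
  constructor
  · rintro ⟨μ, hcs, hct, hd, hh⟩
    obtain ⟨-, x, hx, hle, hn⟩ := YoungDiagram.exists_hookLength_eq_iff.1 hh
    have hsub := fun g => sub_mem_of_mem_pairSemigroup (g := g)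
      ((YoungDiagram.isCore_iff hs).1 hcs) ((YoungDiagram.isCore_iff ht).1 hct) hx
    refine ⟨fun hg => hn (hsub h hg hle), ?_⟩
    rintro y hy ⟨hyG, p, hpG, hpy, hyp⟩
    have := hd.add_lt (hsub y hyG (by omega)) (hsub p hpG (by omega)) (by omega)
    omega
  · rintro ⟨hG, hclose⟩
    classical
    let X : Finset ℕ := (Finset.range (h + 1)).filter fun x => h - x ∈ pairSemigroup s t
    have hX : ∀ x, x ∈ X ↔ x ≤ h ∧ h - x ∈ pairSemigroup s t := by
      intro x
      simp [X]
    have h0 : 0 ∉ X := by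
      rw [hX]
      simpa using hG
    obtain ⟨μ, hμ⟩ := YoungDiagram.exists_betaSet_eq X h0
    refine ⟨μ, ?_, ?_, ?_, ?_⟩
    · rw [YoungDiagram.isCore_iff hs, hμ]
      intro x hx hle
      rw [hX] at hx ⊢
      obtain ⟨hx, a, b, hab⟩ := hx
      exact ⟨by omega, a + 1, b, by rw [Nat.succ_mul]; omega⟩
    · rw [YoungDiagram.isCore_iff ht, hμ]
      intro x hx hle
      rw [hX] at hx ⊢
      obtain ⟨hx, a, b, hab⟩ := hx
      exact ⟨by omega, a, b + 1, by rw [Nat.succ_mul]; omega⟩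
    · apply YoungDiagram.isDistinct_of_add_lt
      rw [hμ]
      intro x hx y hy hxy
      rw [hX] at hx hy
      by_contra hle
      exact hclose (h - x) (by omega) ⟨hx.2, h - y, hy.2, by omega, by omega⟩
    · rw [YoungDiagram.exists_hookLength_eq_iff, hμ]
      have hpos : 0 < h := by
        rcases Nat.eq_zero_or_pos h with rfl | hp
        · exact (hG ⟨0, 0, by simp⟩).elim
        · exact hp
      exact ⟨hpos, h, (hX h).2 ⟨le_rfl, 0, 0, by simp⟩, le_rfl, by simpa using h0⟩

theorem mul_mem_pairSemigroup_iff {b s t x : ℕ} (hb : 0 < b) :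
    b * x ∈ pairSemigroup (b * s) (b * t) ↔ x ∈ pairSemigroup s t := by
  refine exists_congr fun u => exists_congr fun v => ?_
  rw [show u * (b * s) + v * (b * t) = b * (u * s + v * t) by ring]
  exact Nat.mul_right_inj hb.ne'

theorem exists_eq_mul_of_mem_pairSemigroup {b s t x : ℕ}
    (hx : x ∈ pairSemigroup (b * s) (b * t)) : ∃ y, x = b * y := by
  obtain ⟨u, v, rfl⟩ := hx
  exact ⟨u * s + v * t, by ring⟩

theorem mul_isCloseAbove_iff {b c d s t q : ℕ} (hc : c < b) :
    IsCloseAbove (b * d + c) (b * s) (b * t) (b * q) ↔ IsCloseAbove d s t q := by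
  have hb : 0 < b := by omega
  have key : ∀ p, (b * p < b * q ∧ b * q ≤ b * p + (b * d + c)) ↔ (p < q ∧ q ≤ p + d) := by
    intro p
    rw [Nat.mul_lt_mul_left hb, ← Nat.lt_succ_iff (m := q)]
    refine and_congr_right fun _ => ⟨fun h => ?_, fun h => ?_⟩
    · refine Nat.lt_of_mul_lt_mul_left (a := b) ?_
      rw [Nat.succ_eq_add_one, mul_add, mul_add]
      omega
    · have := Nat.mul_le_mul_left b (Nat.lt_succ_iff.1 h)
      rw [mul_add] at this
      omega
  rw [IsCloseAbove, IsCloseAbove, mul_mem_pairSemigroup_iff hb]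
  refine and_congr_right fun _ => ⟨?_, ?_⟩
  · rintro ⟨p, hp, h⟩
    obtain ⟨p, rfl⟩ := exists_eq_mul_of_mem_pairSemigroup hp
    exact ⟨p, (mul_mem_pairSemigroup_iff hb).1 hp, (key p).1 h⟩
  · rintro ⟨p, hp, h⟩
    exact ⟨b * p, (mul_mem_pairSemigroup_iff hb).2 hp, (key p).2 h⟩

theorem isGreatest_mul_coreHookLengths {b c d s t q : ℕ} (hb : 2 ≤ b) (hc : c < b) (hs : 0 < s)
    (ht : 0 < t) (hq : IsLeast {q | IsCloseAbove d s t q} q) :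
    IsGreatest (coreHookLengths (b * d + c) (b * s) (b * t)) (b * q - 1) := by
  have hb0 : 0 < b := by omega
  have hq0 : 0 < q := by
    obtain ⟨-, p, -, hp, -⟩ := hq.1
    omega
  have hbq : b ≤ b * q := Nat.le_mul_of_pos_right b hq0
  constructor
  · rw [mem_coreHookLengths_iff (Nat.mul_pos hb0 hs) (Nat.mul_pos hb0 ht)]
    constructor
    · intro h
      obtain ⟨y, hy⟩ := exists_eq_mul_of_mem_pairSemigroup h
      have h1 : b ∣ 1 := by
        have : b * q - (b * q - 1) = 1 := by omega
        rw [← this]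
        exact Nat.dvd_sub (Dvd.intro _ rfl) ⟨y, hy⟩
      exact absurd (Nat.le_of_dvd one_pos h1) (by omega)
    · intro y hy h
      obtain ⟨y, rfl⟩ := exists_eq_mul_of_mem_pairSemigroup h.1
      have h1 := hq.2 ((mul_isCloseAbove_iff hc).1 h)
      have := Nat.mul_le_mul_left b h1
      omega
  · intro h hh
    rw [mem_coreHookLengths_iff (Nat.mul_pos hb0 hs) (Nat.mul_pos hb0 ht)] at hh
    by_contra hlt
    exact hh.2 (b * q) (by omega) ((mul_isCloseAbove_iff hc).2 hq.1)

theorem isGreatest_coreHookLengths_of_notMem {d s t q : ℕ} (hs : 0 < s) (ht : 0 < t)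
    (hq : IsLeast {q | IsCloseAbove d s t q} (q + 1)) (hG : q ∉ pairSemigroup s t) :
    IsGreatest (coreHookLengths d s t) q := by
  constructor
  · rw [mem_coreHookLengths_iff hs ht]
    refine ⟨hG, fun y hy h => ?_⟩
    have := hq.2 h
    omega
  · intro h hh
    rw [mem_coreHookLengths_iff hs ht] at hh
    by_contra hlt
    exact hh.2 (q + 1) (by omega) hq.1

theorem isGreatest_coreHookLengths_of_mem {d s t q : ℕ} (hs : 0 < s) (ht : 0 < t) (hd : 0 < d)
    (hq : IsLeast {q | IsCloseAbove d s t q} (q + 2)) (hG : q + 1 ∈ pairSemigroup s t) :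
    IsGreatest (coreHookLengths d s t) q := by
  constructor
  · rw [mem_coreHookLengths_iff hs ht]
    refine ⟨fun h => ?_, fun y hy h => ?_⟩
    · have := hq.2 (show IsCloseAbove d s t (q + 1) from ⟨hG, q, h, by omega, by omega⟩)
      omega
    · have := hq.2 h
      omega
  · intro h hh
    rw [mem_coreHookLengths_iff hs ht] at hh
    by_contra hlt
    rcases Nat.eq_or_lt_of_le (show q + 1 ≤ h by omega) with rfl | h2
    · exact hh.1 hG
    · exact hh.2 (q + 2) (by omega) hq.1

theorem sTilde_le_of_modEq {d s k : ℕ} (hsk : s.Coprime k) {N : ℕ} {l : ℤ} (hl0 : l ≠ 0)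
    (hl1 : -(d : ℤ) ≤ l) (hl2 : l ≤ d) (h : (N * s : ℤ) ≡ l [ZMOD k]) : sTilde d s k ≤ N := by
  refine (Nat.sInf_le ?_).trans (Nat.mod_le N k)
  refine ⟨l, hl0, hl1, hl2, ?_⟩
  rw [← (ZMod.intCast_eq_intCast_iff _ _ _).2 h, ZMod.natCast_mod]
  push_cast
  rw [mul_assoc, ZMod.coe_mul_inv_eq_one s hsk, mul_one, ZMod.val_natCast]

theorem exists_sTilde_mul_modEq {d s k : ℕ} (hd : 0 < d) (hk : 0 < k) (hsk : s.Coprime k) :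
    ∃ l : ℤ, l ≠ 0 ∧ -(d : ℤ) ≤ l ∧ l ≤ d ∧ (sTilde d s k * s : ℤ) ≡ l [ZMOD k] := by
  have : NeZero k := ⟨hk.ne'⟩
  obtain ⟨l, h0, h1, h2, h⟩ := Nat.sInf_mem (s := {m | ∃ l : ℤ, l ≠ 0 ∧ -(d : ℤ) ≤ l ∧ l ≤ (d : ℤ) ∧
    m = ((l : ZMod k) * ((s % k : ℕ) : ZMod k)⁻¹).val}) ⟨_, 1, by simp, by omega, by omega, rfl⟩
  refine ⟨l, h0, h1, h2, ?_⟩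
  rw [← ZMod.intCast_eq_intCast_iff]
  push_cast
  rw [sTilde, h, ZMod.natCast_zmod_val, ZMod.natCast_mod, mul_assoc, mul_comm (_⁻¹),
    ZMod.coe_mul_inv_eq_one s hsk, mul_one]

theorem sRes_eq (d s k : ℕ) : sRes d s k = (sTilde d s k * s) % k := by
  rw [sRes, mul_comm, Nat.mul_mod_mod]

theorem sRes_spec {d s k : ℕ} (hd : 0 < d) (hdk : d < k) (hsk : s.Coprime k) :
    0 < sRes d s k ∧ sRes d s k < k ∧ (sRes d s k ≤ d ∨ k ≤ sRes d s k + d) := by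
  obtain ⟨l, h0, h1, h2, h⟩ := exists_sTilde_mul_modEq hd (hd.trans hdk) hsk
  have hr : (sRes d s k : ℤ) = l % k := by
    rw [sRes_eq]
    push_cast
    exact h
  have hlt : sRes d s k < k := Nat.mod_lt _ (hd.trans hdk)
  rcases lt_or_gt_of_ne h0 with hneg | hpos
  · have : l % k = l + k := by
      rw [← Int.add_emod_right]
      exact Int.emod_eq_of_lt (by omega) (by omega)
    omega
  · have : l % k = l := Int.emod_eq_of_lt (by omega) (by omega)
    omega

/-- If `q` is least above an element `p` at distance at most `d`, then one of `p`, `q` is a multiple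
of `s` and the other a multiple of `t`. -/
theorem eq_mul_of_isLeast_isCloseAbove {d s t p q : ℕ} (hds : d < s) (hst : s ≤ t)
    (hq : IsLeast {q | IsCloseAbove d s t q} q) (hqG : q ∈ pairSemigroup s t)
    (hp : p ∈ pairSemigroup s t) (hpq : p < q) (hqp : q ≤ p + d) :
    (∃ i j, q = i * s ∧ p = j * t) ∨ (∃ i j, q = j * t ∧ p = i * s) := by
  obtain ⟨i, j, hij⟩ := hqG
  obtain ⟨i', j', hij'⟩ := hp
  have hi : i = 0 ∨ i' = 0 := by
    rcases i with _ | i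
    · exact Or.inl rfl
    rcases i' with _ | i'
    · exact Or.inr rfl
    rw [Nat.succ_mul] at hij hij'
    have := hq.2 (show IsCloseAbove d s t (q - s) from
      ⟨⟨i, j, by omega⟩, p - s, ⟨i', j', by omega⟩, by omega, by omega⟩)
    omega
  have hj : j = 0 ∨ j' = 0 := by
    rcases j with _ | j
    · exact Or.inl rfl
    rcases j' with _ | j'
    · exact Or.inr rfl
    rw [Nat.succ_mul] at hij hij'
    have := hq.2 (show IsCloseAbove d s t (q - t) from
      ⟨⟨i, j, by omega⟩, p - t, ⟨i', j', by omega⟩, by omega, by omega⟩)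
    omega
  rcases hi with rfl | rfl <;> rcases hj with rfl | rfl
  · omega
  · exact Or.inr ⟨i', j, by omega, by omega⟩
  · exact Or.inl ⟨i, j', by omega, by omega⟩
  · rcases i with _ | i
    · exact Or.inr ⟨0, j, by omega, by omega⟩
    · rw [Nat.succ_mul] at hij
      omega

/-- The distance in a least close pair, in terms of the residue `sRes d s k`. -/
theorem eq_add_of_isLeast_isCloseAbove {d s k p q : ℕ} (hd : 0 < d) (hds : d < s) (hdk : d < k)
    (hsk : s.Coprime k) (hq : IsLeast {q | IsCloseAbove d s (s + k) q} q)
    (hp : p ∈ pairSemigroup s (s + k)) (hpq : p < q) (hqp : q ≤ p + d) :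
    q = p + if sRes d s k ≤ d then sRes d s k else k - sRes d s k := by
  obtain ⟨hr0, hrk, hr⟩ := sRes_spec hd hdk hsk
  have hN : ∀ N j m, 0 < m → m ≤ d → N * s = j * k + m → sTilde d s k ≤ N := by
    intro N j m h0 h1 h
    refine sTilde_le_of_modEq hsk (l := m) (by omega) (by omega) (by omega) ?_
    refine (Int.modEq_iff_dvd.2 ⟨j, ?_⟩).symm
    zify at h
    linarith
  have hN' : ∀ N j m, 0 < m → m ≤ d → N * s + m = j * k → sTilde d s k ≤ N := by
    intro N j m h0 h1 h
    refine sTilde_le_of_modEq hsk (l := -m) (by omega) (by omega) (by omega) ?_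
    refine (Int.modEq_iff_dvd.2 ⟨j, ?_⟩).symm
    zify at h
    linarith
  have hdiv : sTilde d s k * s = (sTilde d s k * s / k) * k + sRes d s k := by
    rw [sRes_eq]
    exact (Nat.div_add_mod' _ _).symm
  generalize sTilde d s k * s / k = J at hdiv
  generalize sTilde d s k = N at hdiv hN hN'
  generalize sRes d s k = r at *
  have hpos : ∀ a b u : ℕ, a ≤ b → a * u ≤ b * u := fun a b u h => Nat.mul_le_mul_right u h
  have hcand : q ≤ if r ≤ d then (N + J) * s else (J + 1) * (s + k) := by
    split_ifs with hrd
    · exact hq.2 ⟨⟨N + J, 0, by ring⟩, J * (s + k), ⟨0, J, by ring⟩, by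
        rw [add_mul, mul_add]; omega, by rw [add_mul, mul_add]; omega⟩
    · refine hq.2 ⟨⟨0, J + 1, by ring⟩, (N + J + 1) * s, ⟨N + J + 1, 0, by ring⟩, ?_, ?_⟩
      all_goals
        rw [mul_add, add_mul (N + J), add_mul N, add_mul J 1 s, add_mul J 1 k]
        omega
  rcases eq_mul_of_isLeast_isCloseAbove hds (Nat.le_add_right s k) hq hq.1.1 hp hpq hqp with
    ⟨i, j, h1, h2⟩ | ⟨i, j, h1, h2⟩
  · have hij : j ≤ i := by
      by_contra hlt
      have := hpos i j s (by omega)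
      rw [mul_add] at h2
      omega
    obtain ⟨M, rfl⟩ := Nat.exists_eq_add_of_le hij
    rw [mul_add] at h2
    rw [add_mul] at h1
    have hNM : N ≤ M := hN M j (q - p) (by omega) (by omega) (by omega)
    have hM := hpos N M s hNM
    split_ifs at hcand ⊢ with hrd
    · rw [add_mul] at hcand
      have hJ : J ≤ j := by
        by_contra hlt
        have := hpos (j + 1) J k (by omega)
        rw [Nat.succ_mul] at this
        omega
      have hJs := hpos J j s hJ
      have e1 : J * s = j * s := by omega
      have e2 : J = j := Nat.eq_of_mul_eq_mul_right (by omega) e1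
      subst e2
      omega
    · have hJ : J + 1 ≤ j := by
        by_contra hlt
        have := hpos j J k (by omega)
        omega
      have a1 := hpos _ _ s hJ
      have a2 := hpos _ _ k hJ
      rw [mul_add] at hcand
      omega
  · have hij : j ≤ i := by
      by_contra hlt
      have := hpos (i + 1) j s (by omega)
      rw [mul_add] at h1
      rw [Nat.succ_mul] at this
      omega
    obtain ⟨M, rfl⟩ := Nat.exists_eq_add_of_le hij
    rw [mul_add] at h1
    rw [add_mul] at h2
    have hNM : N ≤ M := hN' M j (q - p) (by omega) (by omega) (by omega)
    have hM := hpos N M s hNM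
    have hJ : J + 1 ≤ j := by
      by_contra hlt
      have := hpos j J k (by omega)
      omega
    have a1 := hpos _ _ s hJ
    have a2 := hpos _ _ k hJ
    have b1 := Nat.succ_mul J s
    have b2 := Nat.succ_mul J k
    rw [Nat.succ_eq_add_one] at b1 b2
    split_ifs at hcand ⊢ with hrd
    · rw [add_mul] at hcand
      omega
    · rw [mul_add] at hcand
      have e1 : (J + 1) * k = j * k := by omega
      rcases hNM.eq_or_lt with rfl | hlt
      · omega
      · have := hpos _ _ s hlt
        rw [Nat.succ_mul] at this
        omega

theorem exists_isCloseAbove {d s k : ℕ} (hd : 0 < d) (hs : 2 ≤ s) (hk : 0 < k)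
    (hsk : s.Coprime k) : ∃ q, IsCloseAbove d s (s + k) q := by
  obtain ⟨N, j, h⟩ : ∃ N j, N * s = j * k + 1 := by
    rcases Nat.lt_or_ge 1 k with hk1 | hk1
    · obtain ⟨N, -, h⟩ := Nat.exists_mul_mod_eq_one_of_coprime hsk hk1
      refine ⟨N, s * N / k, ?_⟩
      have := Nat.div_add_mod' (s * N) k
      rw [h] at this
      rw [this, mul_comm]
    · obtain rfl : k = 1 := by omega
      exact ⟨1, s - 1, by omega⟩
  exact ⟨(N + j) * s, ⟨N + j, 0, by ring⟩, j * (s + k), ⟨0, j, by ring⟩,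
    by rw [add_mul, mul_add]; omega, by rw [add_mul, mul_add]; omega⟩

theorem le_of_mem_pairSemigroup {s t x : ℕ} (hst : s ≤ t) (hx : x ∈ pairSemigroup s t)
    (h0 : 0 < x) : s ≤ x := by
  obtain ⟨i, j, h⟩ := hx
  rcases i with _ | i
  · rcases j with _ | j
    · omega
    · rw [Nat.succ_mul] at h
      omega
  · rw [Nat.succ_mul] at h
    omega

theorem eq_zero_or_eq_of_mem_pairSemigroup {s t x : ℕ} (ht : t ≤ 2 * s)
    (hx : x ∈ pairSemigroup s t) (hxt : x < t) : x = 0 ∨ x = s := by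
  obtain ⟨i, j, h⟩ := hx
  rcases j with _ | j
  · rcases i with _ | _ | i
    · omega
    · omega
    · rw [Nat.succ_mul, Nat.succ_mul] at h
      omega
  · rw [Nat.succ_mul] at h
    omega

theorem isLeast_isCloseAbove_of_le {d s t : ℕ} (hs : 0 < s) (hst : s ≤ t) (hsd : s ≤ d) :
    IsLeast {q | IsCloseAbove d s t q} s := by
  refine ⟨⟨⟨1, 0, by ring⟩, 0, ⟨0, 0, by ring⟩, hs, by omega⟩, ?_⟩
  rintro q ⟨hq, p, -, hpq, -⟩
  exact le_of_mem_pairSemigroup hst hq (by omega)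

theorem isLeast_isCloseAbove_of_le_of_lt {d s k : ℕ} (hk : 0 < k) (hkd : k ≤ d) (hds : d < s) :
    IsLeast {q | IsCloseAbove d s (s + k) q} (s + k) := by
  refine ⟨⟨⟨0, 1, by ring⟩, s, ⟨1, 0, by ring⟩, by omega, by omega⟩, ?_⟩
  rintro q ⟨hq, p, hp, hpq, hqp⟩
  by_contra hlt
  have h1 := eq_zero_or_eq_of_mem_pairSemigroup (by omega) hq (by omega)
  have h2 := eq_zero_or_eq_of_mem_pairSemigroup (by omega) hp (by omega)
  omega

theorem notMem_of_isLeast_of_le {d s t q : ℕ} (hs : 2 ≤ s) (hst : s ≤ t) (hsd : s ≤ d)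
    (hq : IsLeast {q | IsCloseAbove d s t q} (q + 1)) : q ∉ pairSemigroup s t := by
  have := hq.unique (isLeast_isCloseAbove_of_le (by omega) hst hsd)
  intro h
  have := le_of_mem_pairSemigroup hst h (by omega)
  omega

theorem notMem_of_isLeast_of_le_of_lt {d s k q : ℕ} (hk : 1 < k) (hkd : k ≤ d) (hds : d < s)
    (hq : IsLeast {q | IsCloseAbove d s (s + k) q} (q + 1)) : q ∉ pairSemigroup s (s + k) := by
  have := hq.unique (isLeast_isCloseAbove_of_le_of_lt (by omega) hkd hds)
  intro h
  have := eq_zero_or_eq_of_mem_pairSemigroup (by omega) h (by omega)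
  omega

theorem sRes_eq_self_of_le {d s k : ℕ} (hs : 2 ≤ s) (hsd : s ≤ d) (hdk : d < k)
    (hsk : s.Coprime k) : sRes d s k = s := by
  have h0 := (sRes_spec (by omega) hdk hsk).1
  have h1 : sTilde d s k ≤ 1 :=
    sTilde_le_of_modEq hsk (l := s) (by omega) (by omega) (by omega) (by simp)
  rw [sRes_eq] at h0 ⊢
  interval_cases sTilde d s k
  · simp at h0
  · rw [one_mul, Nat.mod_eq_of_lt (by omega)]

theorem pred_mem_pairSemigroup_iff {d s k q : ℕ} (hs : 2 ≤ s) (hd : 0 < d) (hdk : d < k)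
    (hsk : s.Coprime k) (hq : IsLeast {q | IsCloseAbove d s (s + k) q} (q + 1)) :
    q ∈ pairSemigroup s (s + k) ↔ sRes d s k = 1 ∨ (d < sRes d s k ∧ sRes d s k = k - 1) := by
  rcases Nat.lt_or_ge d s with hds | hsd
  · constructor
    · intro h
      have := eq_add_of_isLeast_isCloseAbove hd hds hdk hsk hq h (by omega) (by omega)
      split_ifs at this <;> omega
    · intro h
      obtain ⟨-, p, hp, hpq, hqp⟩ := hq.1
      have := eq_add_of_isLeast_isCloseAbove hd hds hdk hsk hq hp hpq hqp
      obtain rfl : q = p := by split_ifs at this <;> omega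
      exact hp
  · refine iff_of_false (notMem_of_isLeast_of_le hs (Nat.le_add_right s k) hsd hq) ?_
    rw [sRes_eq_self_of_le hs hsd hdk hsk]
    omega

theorem theorem1p2 (s k d b c : ℕ) (hs : 2 ≤ s) (hk : 0 < k) (hd : 0 < d)
    (hsk : Nat.Coprime s k) (hb : 2 ≤ b) (hc : c < b) :
    -- both maxima are attained
    IsGreatest (coreHookLengths d s (s + k)) (maxHook d s k) ∧
    IsGreatest (coreHookLengths (b * d + c) (b * s) (b * s + b * k))
      (maxHook (b * d + c) (b * s) (b * k)) ∧
    -- the four cases of the formula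
    (k = 1 ∧ d < s →
      maxHook (b * d + c) (b * s) (b * k) = b * (maxHook d s k + 2) - 1) ∧
    (k = 1 ∧ s ≤ d →
      maxHook (b * d + c) (b * s) (b * k) = b * (maxHook d s k + 1) - 1) ∧
    (d < k ∧ (sRes d s k = 1 ∨ (d < sRes d s k ∧ sRes d s k = k - 1)) →
      maxHook (b * d + c) (b * s) (b * k) = b * (maxHook d s k + 2) - 1) ∧
    (1 < k ∧ ((1 < sRes d s k ∧ sRes d s k ≤ d) ∨ (d < sRes d s k ∧ sRes d s k < k - 1) ∨ k ≤ d) →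
      maxHook (b * d + c) (b * s) (b * k) = b * (maxHook d s k + 1) - 1) ∧
    -- the four cases exhaust all parameters
    ((k = 1 ∧ d < s) ∨ (k = 1 ∧ s ≤ d) ∨
      (d < k ∧ (sRes d s k = 1 ∨ (d < sRes d s k ∧ sRes d s k = k - 1))) ∨
      (1 < k ∧
        ((1 < sRes d s k ∧ sRes d s k ≤ d) ∨ (d < sRes d s k ∧ sRes d s k < k - 1) ∨ k ≤ d))) := by
  have hs0 : 0 < s := by omega
  have ht0 : 0 < s + k := by omega
  obtain ⟨q, hq, hq1⟩ : ∃ q, IsLeast {q | IsCloseAbove d s (s + k) q} (q + 1) ∧ 1 ≤ q := by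
    classical
    have hex := exists_isCloseAbove hd hs hk hsk
    have hle := le_of_mem_pairSemigroup (Nat.le_add_right s k) (Nat.find_spec hex).1
      (by obtain ⟨-, p, -, hp, -⟩ := Nat.find_spec hex; omega)
    refine ⟨Nat.find hex - 1, ?_, by omega⟩
    rw [Nat.sub_add_cancel (by omega)]
    exact ⟨Nat.find_spec hex, fun y hy => Nat.find_min' hex hy⟩
  have hscaled := isGreatest_mul_coreHookLengths hb hc hs0 ht0 hq
  rw [mul_add b s k] at hscaled
  have hM : maxHook (b * d + c) (b * s) (b * k) = b * (q + 1) - 1 := hscaled.csSup_eq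
  have hnot : q ∉ pairSemigroup s (s + k) →
      IsGreatest (coreHookLengths d s (s + k)) (maxHook d s k) ∧ maxHook d s k = q := by
    intro h
    have h1 := isGreatest_coreHookLengths_of_notMem hs0 ht0 hq h
    have h2 : maxHook d s k = q := h1.csSup_eq
    exact ⟨h2.symm ▸ h1, h2⟩
  have hmem : q ∈ pairSemigroup s (s + k) →
      IsGreatest (coreHookLengths d s (s + k)) (maxHook d s k) ∧ maxHook d s k + 1 = q := by
    intro h
    obtain ⟨q, rfl⟩ := Nat.exists_eq_add_of_le' hq1
    have h1 := isGreatest_coreHookLengths_of_mem hs0 ht0 hd hq h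
    have h2 : maxHook d s k = q := h1.csSup_eq
    exact ⟨h2.symm ▸ h1, by rw [h2]⟩
  refine ⟨?_, hM ▸ hscaled, ?_, ?_, ?_, ?_, ?_⟩
  · by_cases h : q ∈ pairSemigroup s (s + k)
    · exact (hmem h).1
    · exact (hnot h).1
  · rintro ⟨rfl, hds⟩
    have := hq.unique (isLeast_isCloseAbove_of_le_of_lt one_pos hd hds)
    obtain rfl : q = s := by omega
    have h := (hmem ⟨1, 0, by ring⟩).2
    rw [hM, show maxHook d q 1 + 2 = q + 1 by omega]
  · rintro ⟨-, hsd⟩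
    rw [hM, (hnot (notMem_of_isLeast_of_le hs (Nat.le_add_right s k) hsd hq)).2]
  · rintro ⟨hdk, h⟩
    rw [hM, ← (hmem ((pred_mem_pairSemigroup_iff hs hd hdk hsk hq).2 h)).2]
  · rintro ⟨hk1, h⟩
    have hqG : q ∉ pairSemigroup s (s + k) := by
      rcases Nat.lt_or_ge d k with hdk | hkd
      · rw [pred_mem_pairSemigroup_iff hs hd hdk hsk hq]
        omega
      · rcases Nat.lt_or_ge d s with hds | hsd
        · exact notMem_of_isLeast_of_le_of_lt hk1 hkd hds hq
        · exact notMem_of_isLeast_of_le hs (Nat.le_add_right s k) hsd hq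
    rw [hM, (hnot hqG).2]
  · rcases Nat.lt_or_ge d k with hdk | hkd
    · have := sRes_spec hd hdk hsk
      omega
    · omega
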